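/- All rings are associative with identity, not necessarily commutative. Write $J(R)$ for the Jacobson radical of a ring $R$. For $k\ge 1$, $R$ is called $k$-UU if $u^k-1$ is nilpotent for every unit $u$ of $R$. For $n\ge 2$, $R$ is called strongly $n$-nil-clean if every $a\in R$ can be written as $a=e+b$ with $e^n=e$, $b$ nilpotent and $eb=be$. $R$ is called semilocal if $R/J(R)$ is semisimple. A subdirect product of a (possibly empty) family of rings is a ring isomorphic to a subring of their direct product that is mapped onto each factor by the corresponding projection. Theorem. Let $R$ be a ring and let $n\ge 2$ be an integer. Consider the following three conditions: (i) $R$ is $(n-1)$-UU; (ii) $R$ is strongly $n$-nil-clean; (iii) every element of $J(R)$ is nilpotent, and $R/J(R)$ is a subdirect product of a family of matrix rings $M_m(F)$, where for each member of the family $m\ge 1$ is an integer and $F$ is a finite field ($m$ and $F$ may vary with the member) such that $(|F|^i-1)\mid(n-1)$ for every $1\le i\le m$. Then (iii) $\Rightarrow$ (ii) $\Rightarrow$ (i). If, moreover, $R$ is semilocal and either $n$ is even, or $n=2^k+1$ for some integer $k\ge 0$, or $n=7$, or $n=11$, then (i), (ii) and (iii) are equivalent. -/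

import Mathlib

universe u

/-- A ring is `k`-UU if `u ^ k - 1` is nilpotent for every unit `u`. -/
def IsNUU (k : ℕ) (R : Type*) [Ring R] : Prop :=
  ∀ u : Rˣ, IsNilpotent ((u : R) ^ k - 1)

/-- A ring is strongly `n`-nil-clean if each element is the sum of an `n`-potent element and a
nilpotent element which commute with each other. -/
def IsStronglyNNilClean (n : ℕ) (R : Type*) [Ring R] : Prop :=
  ∀ a : R, ∃ e b : R, e ^ n = e ∧ IsNilpotent b ∧ Commute e b ∧ a = e + b

/-- A ring is semilocal if its quotient by the Jacobson radical is semisimple. -/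
def IsSemilocal (R : Type*) [Ring R] : Prop :=
  IsSemisimpleRing (R ⧸ Ring.jacobson R)

/-- `S` is (isomorphic to) a subdirect product of the rings `A i`: it embeds in their direct
product so that every coordinate projection is surjective on it. -/
def IsSubdirectProduct (S : Type*) [Ring S] {ι : Type*} (A : ι → Type*) [∀ i, Ring (A i)] :
    Prop :=
  ∃ f : S →+* (∀ i, A i), Function.Injective f ∧ ∀ i, Function.Surjective fun s => f s i

/-- The Jacobson radical of `R` is nil, and the quotient by it is a subdirect product of full
matrix rings `M_m(F)`, `m ≥ 1`, over finite fields `F` such that `|F| ^ j - 1` divides `n - 1` for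
all `1 ≤ j ≤ m`. (Index sets and finite fields in the universe of `R` are no restriction: a
subdirect product can be reindexed by the kernels of its projections.) -/
def IsNilJacobsonSubdirectMatrix (n : ℕ) (R : Type u) [Ring R] : Prop :=
  (∀ a ∈ Ring.jacobson R, IsNilpotent a) ∧
  ∃ (ι : Type u) (F : ι → Type u) (_ : ∀ i, Field (F i)) (m : ι → ℕ),
    (∀ i, Finite (F i)) ∧ (∀ i, 1 ≤ m i) ∧
    (∀ i j, 1 ≤ j → j ≤ m i → (Nat.card (F i) ^ j - 1) ∣ (n - 1)) ∧
    IsSubdirectProduct (R ⧸ Ring.jacobson R) (fun i => Matrix (Fin (m i)) (Fin (m i)) (F i))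

/-! (iii) ⇒ (ii): factoring characteristic polynomials over `F` shows every `a ^ n - a` nilpotent,
and `n!` is nilpotent too. In `ℤ[a]`, of positive characteristic, an `n`-potent near `a` is `a ^ p ^
M` when `p` is nilpotent; the Chinese remainder theorem glues these. (ii) ⇒ (i): a unit's potent
part is a unit, so its `(n-1)`-th power is 1. (i) ⇒ (iii): by Wedderburn–Artin, `R/J` is a finite
product of matrix rings over division rings in which `x ^ (n - 1) = 1` for `x ≠ 0`. These are
finite, hence fields; Singer cycles give the divisibilities. As `R/J` is finite, `R` has positive
characteristic, which makes `J` nil. -/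

open Polynomial

/-! ### Division rings of bounded exponent -/

theorem finite_and_card_le_of_pow_eq_one {A : Type*} [CommRing A] [IsDomain A] {k : ℕ}
    (hk : k ≠ 0) (h : ∀ x : A, x ≠ 0 → x ^ k = 1) : Finite A ∧ Nat.card A ≤ k + 1 := by
  classical
  have key : ∀ x : A, x ∈ insert 0 (nthRoots k (1 : A)).toFinset := by
    intro x
    by_cases hx : x = 0
    · simp [hx]
    · simp [mem_nthRoots (Nat.pos_of_ne_zero hk), h x hx]
  have hf : Finite A := Set.finite_univ_iff.mp
    ((insert 0 (nthRoots k (1 : A)).toFinset).finite_toSet.subset fun x _ => key x)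
  refine ⟨hf, ?_⟩
  have := Fintype.ofFinite A
  rw [Nat.card_eq_fintype_card, ← Finset.card_univ]
  calc _ ≤ (insert 0 (nthRoots k (1 : A)).toFinset).card :=
        Finset.card_le_card fun x _ => key x
    _ ≤ _ := (Finset.card_insert_le _ _).trans
        (Nat.add_le_add_right ((Multiset.toFinset_card_le _).trans (card_nthRoots _ _)) 1)

theorem finite_ker_aeval_prod {F V : Type*} [CommRing F] [AddCommGroup V] [Module F V]
    (f : Module.End F V) (hf : ∀ c : F, {x | f x = c • x}.Finite) (s : Multiset F) :
    {x | aeval f (s.map fun c => X - C c).prod x = 0}.Finite := by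
  induction s using Multiset.induction with
  | empty => simp
  | cons c s ih =>
    have : {x | aeval f ((c ::ₘ s).map fun c => X - C c).prod x = 0} =
        (aeval f (X - C c)) ⁻¹' {x | aeval f (s.map fun c => X - C c).prod x = 0} := by
      ext x
      rw [Multiset.map_cons, Multiset.prod_cons, mul_comm]
      simp
    rw [this]
    refine ih.preimage' fun b _ => ?_
    by_cases hb : ∃ x₀, aeval f (X - C c) x₀ = b
    · obtain ⟨x₀, rfl⟩ := hb
      refine ((hf c).image (x₀ + ·)).subset fun x hx => ⟨x - x₀, ?_, by simp⟩
      have h0 : aeval f (X - C c) (x - x₀) = 0 := by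
        rw [map_sub, sub_eq_zero]; exact hx
      simpa [sub_eq_zero] using h0
    · convert Set.finite_empty
      ext x
      simp only [Set.mem_preimage, Set.mem_singleton_iff, Set.mem_empty_iff_false, iff_false]
      exact fun h => hb ⟨x, h⟩

/-- Commutative subrings have at most `k + 1` elements, so one of greatest cardinality exists. It is
a finite field that contains its centralizer; take `a` to generate its unit group. -/
theorem exists_finite_centralizer {D : Type*} [DivisionRing D] {k : ℕ} (hk : k ≠ 0)
    (h : ∀ x : D, x ≠ 0 → x ^ k = 1) :
    ∃ S : Subring D, Finite S ∧ (∀ x ∈ S, ∀ y ∈ S, x * y = y * x) ∧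
      ∃ a ∈ S, ∀ x, Commute x a → x ∈ S := by
  have bound : ∀ S : Subring D, (∀ x ∈ S, ∀ y ∈ S, x * y = y * x) →
      Finite S ∧ Nat.card S ≤ k + 1 := by
    intro S hS
    let _ : CommRing S := { S.toRing with mul_comm := fun x y => Subtype.ext (hS x x.2 y y.2) }
    exact finite_and_card_le_of_pow_eq_one hk fun x hx =>
      Subtype.ext (h x fun h0 => hx (Subtype.ext h0))
  let T : Set ℕ := {m | ∃ S : Subring D, (∀ x ∈ S, ∀ y ∈ S, x * y = y * x) ∧ Nat.card S = m}
  have hbdd : BddAbove T := ⟨k + 1, by rintro _ ⟨S, hS, rfl⟩; exact (bound S hS).2⟩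
  have hne : T.Nonempty := ⟨_, Subring.center D,
    fun x _ y hy => (Subring.mem_center_iff.mp hy x), rfl⟩
  obtain ⟨S, hS, hcard⟩ := Nat.sSup_mem hne hbdd
  have hfin := (bound S hS).1
  have hmax : ∀ c, (∀ x ∈ S, x * c = c * x) → c ∈ S := by
    intro c hc
    have hcomm : ∀ x ∈ insert c (S : Set D), ∀ y ∈ insert c (S : Set D), x * y = y * x := by
      rintro x (rfl | hx) y (rfl | hy)
      · rfl
      · exact (hc y hy).symm
      · exact hc x hx
      · exact hS x hx y hy
    have hT : ∀ x ∈ Subring.closure (insert c (S : Set D)),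
        ∀ y ∈ Subring.closure (insert c (S : Set D)), x * y = y * x := fun x hx y hy =>
      congrArg Subtype.val ((Subring.isMulCommutative_closure hcomm).is_comm.comm ⟨x, hx⟩ ⟨y, hy⟩)
    have hle : (S : Set D) ⊆ Subring.closure (insert c (S : Set D)) :=
      (Set.subset_insert _ _).trans Subring.subset_closure
    have hT' := (bound _ hT).1
    have heq := Set.eq_of_subset_of_ncard_le hle (by
      change Nat.card (Subring.closure (insert c (S : Set D))) ≤ Nat.card S
      rw [hcard]
      exact le_csSup hbdd ⟨_, hT, rfl⟩) (Set.toFinite _)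
    have : c ∈ (Subring.closure (insert c (S : Set D)) : Set D) :=
      Subring.subset_closure (Set.mem_insert _ _)
    rwa [← heq] at this
  refine ⟨S, hfin, hS, ?_⟩
  let _ : CommRing S := { S.toRing with mul_comm := fun x y => Subtype.ext (hS x x.2 y y.2) }
  obtain ⟨g, hg⟩ := IsCyclic.exists_generator (α := Sˣ)
  refine ⟨(g : S), (g : S).2, fun x hx => hmax x fun s hs => ?_⟩
  by_cases hs0 : s = 0
  · simp [hs0]
  have hsu : (⟨s, hs⟩ : S) ^ k = 1 :=
    Subtype.ext (h s hs0)
  have hu : IsUnit (⟨s, hs⟩ : S) := IsUnit.of_pow_eq_one hsu hk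
  obtain ⟨m, hm⟩ := (mem_powers_iff_mem_zpowers).mpr (hg hu.unit)
  have : s = ((g : S) : D) ^ m := by
    have := congrArg (fun u : Sˣ => ((u : S) : D)) hm
    simpa using this.symm
  rw [this]
  exact (hx.symm.pow_left m)

/-- A weak form of Jacobson's theorem. -/
theorem DivisionRing.finite_of_pow_eq_one {D : Type*} [DivisionRing D] {k : ℕ} (hk : k ≠ 0)
    (h : ∀ x : D, x ≠ 0 → x ^ k = 1) : Finite D := by
  obtain ⟨S, hfin, hS, a, ha, hcent⟩ := exists_finite_centralizer hk h
  let _ : Field S := (Finite.isDomain_to_isField S).toField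
  have := Fintype.ofFinite S
  -- Right multiplication by `a` is killed by `X ^ |S| - X`, which splits over `S`. Left
  -- multiplication by `y⁻¹`, for an eigenvector `y`, carries its eigenspace into the centralizer of
  -- `a`, so eigenspaces are finite.
  let f : Module.End S D :=
    { toFun := fun x => x * a
      map_add' := fun x y => add_mul x y a
      map_smul' := fun c x => mul_assoc (c : D) x a }
  have hf : ∀ c : S, {x | f x = c • x}.Finite := by
    intro c
    by_cases hy : ∃ y, y ≠ 0 ∧ f y = c • y
    · obtain ⟨y, hy0, hy⟩ := hy
      refine ((Set.toFinite (S : Set D)).image (y * ·)).subset fun x hx =>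
        ⟨y⁻¹ * x, hcent _ ?_, mul_inv_cancel_left₀ hy0 x⟩
      have hx' : x * a = c * x := hx
      have hy' : y * a = c * y := hy
      have hc : (c : D) = y * a * y⁻¹ := by rw [hy', mul_inv_cancel_right₀ hy0]
      rw [Commute, SemiconjBy, mul_assoc, hx', hc]
      simp [mul_assoc, hy0]
    · push Not at hy
      refine (Set.finite_singleton 0).subset fun x hx => ?_
      by_contra h0
      exact hy x h0 hx
  have hpow : ∀ m x, (f ^ m) x = x * a ^ m := by
    intro m
    induction m with
    | zero => simp
    | succ m ih =>
      intro x
      rw [pow_succ, Module.End.mul_apply, ih, pow_succ', ← mul_assoc]; rfl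
  have hprod : (X ^ Fintype.card S - X : S[X]) =
      ((Finset.univ : Finset S).val.map fun c => X - C c).prod := by
    rw [← FiniteField.roots_X_pow_card_sub_X S]
    refine (prod_multiset_X_sub_C_of_monic_of_roots_card_eq
      (monic_X_pow_sub (by simpa using Fintype.one_lt_card)) ?_).symm
    rw [FiniteField.roots_X_pow_card_sub_X, FiniteField.X_pow_card_sub_X_natDegree_eq _
      Fintype.one_lt_card]
    rfl
  have hfinal := finite_ker_aeval_prod f hf (Finset.univ : Finset S).val
  rw [← hprod] at hfinal
  refine Set.finite_univ_iff.mp (hfinal.subset fun x _ => ?_)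
  have haq : a ^ Fintype.card S = a := congrArg Subtype.val (FiniteField.pow_card (⟨a, ha⟩ : S))
  simp only [map_sub, map_pow, aeval_X, Set.mem_ofPred_eq, LinearMap.sub_apply, hpow, haq]
  exact sub_self _

/-! ### Units of matrix rings -/

section Units

variable {k : ℕ}

theorem IsNUU.of_injective {R S : Type*} [Ring R] [Ring S] (f : R →+* S)
    (hf : Function.Injective f) (h : IsNUU k S) : IsNUU k R := fun u =>
  (IsNilpotent.map_iff hf).mp (by simpa using h (Units.map (f : R →* S) u))

theorem IsNUU.pi_apply {ι : Type*} {A : ι → Type*} [∀ i, Ring (A i)] (h : IsNUU k (∀ i, A i))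
    (i : ι) : IsNUU k (A i) := by
  classical
  intro u
  have := (h (MulEquiv.piUnits.symm (Function.update 1 i u))).map (Pi.evalRingHom A i)
  simpa using this

theorem IsNUU.pow_eq_one_of_matrix {D : Type*} [DivisionRing D] {m : ℕ} [NeZero m]
    (h : IsNUU k (Matrix (Fin m) (Fin m) D)) (x : D) (hx : x ≠ 0) : x ^ k = 1 := by
  have h1 : IsNUU k (Fin m → D) :=
    h.of_injective (Matrix.diagonalRingHom (Fin m) D) Matrix.diagonal_injective
  exact sub_eq_zero.mp (h1.pi_apply 0 (Units.mk0 x hx)).eq_zero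

/-- A generator of `Kˣ`, `[K : F] = j`, acts on `K × F ^ (m - j)`, of dimension `m`, fixing the
second factor. Its order `|F| ^ j - 1` must divide `k`, because `K` is reduced. -/
theorem IsNUU.card_pow_sub_one_dvd {F : Type*} [Field F] [Finite F] {m : ℕ}
    (h : IsNUU k (Matrix (Fin m) (Fin m) F)) {j : ℕ} (hj : 1 ≤ j) (hjm : j ≤ m) :
    Nat.card F ^ j - 1 ∣ k := by
  obtain ⟨p, hp⟩ := CharP.exists F
  have : Fact p.Prime := ⟨CharP.char_is_prime F p⟩
  have : NeZero j := ⟨by omega⟩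
  let K := FiniteField.Extension F p j
  have hdim : Module.finrank F (K × (Fin (m - j) → F)) = m := by
    rw [Module.finrank_prod, FiniteField.finrank_extension, Module.finrank_fin_fun]
    omega
  let b : Module.Basis (Fin m) F (K × (Fin (m - j) → F)) := Module.finBasisOfFinrankEq _ _ hdim
  have hE : IsNUU k (Module.End F (K × (Fin (m - j) → F))) :=
    h.of_injective (LinearMap.toMatrixAlgEquiv b).toRingEquiv.toRingHom
      (LinearMap.toMatrixAlgEquiv b).injective
  let φ : K →* Module.End F (K × (Fin (m - j) → F)) :=
    { toFun := fun x => (LinearMap.mulLeft F x).prodMap LinearMap.id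
      map_one' := by ext <;> simp
      map_mul' := fun x y => by ext <;> simp }
  obtain ⟨g, hg⟩ := IsCyclic.exists_ofOrder_eq_natCard (α := Kˣ)
  obtain ⟨N, hN⟩ := hE (Units.map φ g)
  have hpow : ∀ N x, ((((Units.map φ g : (Module.End F (K × (Fin (m - j) → F)))ˣ) :
      Module.End F (K × (Fin (m - j) → F))) ^ k - 1) ^ N) (x, 0) =
      (((g : K) ^ k - 1) ^ N * x, 0) := by
    intro N
    induction N with
    | zero => simp
    | succ N ih =>
      intro x
      rw [pow_succ, Module.End.mul_apply, Units.coe_map, ← MonoidHom.map_pow]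
      rw [Units.coe_map, ← MonoidHom.map_pow] at ih
      have : (φ ((g : K) ^ k) - 1) (x, 0) = (((g : K) ^ k - 1) * x, 0) := by
        simp [φ, sub_mul]
      exact (congrArg _ this).trans (by rw [ih, pow_succ, mul_assoc])
  have h0 := hpow N 1
  rw [hN] at h0
  have h1 : ((g : K) ^ k - 1) ^ N = 0 := by simpa using (congrArg Prod.fst h0).symm
  have h2 : g ^ k = 1 := Units.ext (by
    simpa using sub_eq_zero.mp (IsNilpotent.eq_zero ⟨N, h1⟩))
  rw [← orderOf_dvd_iff_pow_eq_one, hg, Nat.card_units, FiniteField.natCard_extension] at h2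
  exact h2

end Units

/-! ### Jacobson radical -/

section Jacobson

variable {R : Type*} [Ring R]

theorem Ring.isUnit_one_add_of_mem_jacobson {j : R} (hj : j ∈ Ring.jacobson R) :
    IsUnit (1 + j) := by
  have key : ∀ x ∈ Ring.jacobson R, ∃ s, s * (1 + x) = 1 := by
    intro x hx
    rw [← Ideal.jacobson_bot] at hx
    obtain ⟨s, hs⟩ := Ideal.exists_mul_add_sub_mem_of_mem_jacobson x hx
    exact ⟨s, by rw [Ideal.mem_bot, sub_eq_zero] at hs; rw [add_comm]; exact hs⟩
  obtain ⟨s, hs⟩ := key j hj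
  obtain ⟨t, ht⟩ := key (-(s * j)) (neg_mem (Ideal.mul_mem_left _ s hj))
  have h1 : 1 + -(s * j) = s := by rw [← hs]; noncomm_ring
  rw [h1] at ht
  have h2 : t = 1 + j := by
    calc t = t * (s * (1 + j)) := by rw [hs, mul_one]
      _ = 1 + j := by rw [← mul_assoc, ht, one_mul]
  exact ⟨⟨1 + j, s, h2 ▸ ht, hs⟩, rfl⟩

theorem Ring.isUnit_of_isUnit_mk_jacobson {x : R}
    (hx : IsUnit (Ideal.Quotient.mk (Ring.jacobson R) x)) : IsUnit x := by
  obtain ⟨y, hxy, hyx⟩ := isUnit_iff_exists.mp hx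
  obtain ⟨y, rfl⟩ := Ideal.Quotient.mk_surjective y
  have aux : ∀ a b : R, Ideal.Quotient.mk (Ring.jacobson R) a *
      Ideal.Quotient.mk (Ring.jacobson R) b = 1 → IsUnit (a * b) := by
    intro a b hab
    have : a * b - 1 ∈ Ring.jacobson R := by
      rw [← Ideal.Quotient.eq_zero_iff_mem]; simp [hab]
    simpa using Ring.isUnit_one_add_of_mem_jacobson this
  obtain ⟨u, hu⟩ := aux x y hxy
  obtain ⟨v, hv⟩ := aux y x hyx
  refine isUnit_iff_exists_and_exists.mpr ⟨⟨y * ↑u⁻¹, ?_⟩, ⟨↑v⁻¹ * y, ?_⟩⟩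
  · rw [← mul_assoc, ← hu, Units.mul_inv]
  · rw [mul_assoc, ← hv, Units.inv_mul]

theorem IsNUU.quotient_jacobson {k : ℕ} (h : IsNUU k R) : IsNUU k (R ⧸ Ring.jacobson R) := by
  intro u
  obtain ⟨x, hx⟩ := Ideal.Quotient.mk_surjective (u : R ⧸ Ring.jacobson R)
  obtain ⟨v, rfl⟩ := Ring.isUnit_of_isUnit_mk_jacobson (hx ▸ u.isUnit)
  have := (h v).map (Ideal.Quotient.mk (Ring.jacobson R))
  simpa [hx] using this

/-- `1 + j` is integral over the finite ring `ZMod c`, so the powers of `j` repeat: `j ^ a = j ^ b`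
with `a < b`. Cancel the unit `1 - j ^ (b - a)`. -/
theorem IsNUU.isNilpotent_of_mem_jacobson {k d : ℕ} (hk : k ≠ 0) (hd : d ≠ 0)
    (hdR : (d : R) = 0) (h : IsNUU k R) {j : R} (hj : j ∈ Ring.jacobson R) : IsNilpotent j := by
  obtain ⟨c, hc⟩ := CharP.exists R
  have hc0 : NeZero c := ⟨fun h0 => hd (by
    rw [CharP.cast_eq_zero_iff R c, h0, zero_dvd_iff] at hdR; exact hdR)⟩
  let _ := ZMod.algebra R c
  obtain ⟨u, hu⟩ := Ring.isUnit_one_add_of_mem_jacobson hj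
  obtain ⟨N, hN⟩ := h u
  have hint : IsIntegral (ZMod c) (1 + j) := by
    refine ⟨(X ^ k - 1) ^ N, (monic_X_pow_sub_C 1 hk).pow N, ?_⟩
    rw [← aeval_def]
    simpa [← hu] using hN
  have : Module.Finite (ZMod c) (Algebra.adjoin (ZMod c) {1 + j}) :=
    Module.Finite.iff_fg.mpr hint.fg_adjoin_singleton
  have : Finite (Algebra.adjoin (ZMod c) {1 + j}) := Module.finite_of_finite (ZMod c)
  have hmem : j ∈ Algebra.adjoin (ZMod c) {1 + j} := by
    have := sub_mem (Algebra.subset_adjoin (R := ZMod c) (Set.mem_singleton (1 + j))) (one_mem _)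
    rwa [add_sub_cancel_left] at this
  obtain ⟨a, b, hab, hne⟩ : ∃ a b, a < b ∧ j ^ a = j ^ b := by
    let f : ℕ → Algebra.adjoin (ZMod c) {1 + j} := fun a =>
      ⟨j, hmem⟩ ^ a
    obtain ⟨a, b, hne, hab⟩ := Finite.exists_ne_map_eq_of_infinite f
    have hab' : j ^ a = j ^ b := congrArg Subtype.val hab
    rcases lt_or_gt_of_ne hne with h | h
    · exact ⟨a, b, h, hab'⟩
    · exact ⟨b, a, h, hab'.symm⟩
  refine ⟨a, ?_⟩
  have hu : IsUnit (1 + -(j ^ (b - a))) := Ring.isUnit_one_add_of_mem_jacobson (neg_mem (by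
    rw [← Nat.sub_add_cancel (Nat.sub_pos_of_lt hab), pow_succ]
    exact Ideal.mul_mem_left _ _ hj))
  rw [← hu.mul_left_eq_zero, mul_add, mul_neg, ← pow_add, Nat.add_sub_cancel' hab.le, hne]
  simp

end Jacobson

theorem IsNUU.isNilJacobsonSubdirectMatrix {R : Type u} [Ring R] {n : ℕ} (hn : 2 ≤ n)
    (hs : IsSemilocal R) (h : IsNUU (n - 1) R) : IsNilJacobsonSubdirectMatrix n R := by
  have hk : n - 1 ≠ 0 := by omega
  have : IsSemisimpleRing (R ⧸ Ring.jacobson R) := hs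
  obtain ⟨r, D, d, _, hd, ⟨e⟩⟩ :=
    IsSemisimpleRing.exists_ringEquiv_pi_matrix_divisionRing (R ⧸ Ring.jacobson R)
  have hpi : IsNUU (n - 1) (∀ i, Matrix (Fin (d i)) (Fin (d i)) (D i)) :=
    h.quotient_jacobson.of_injective e.symm.toRingHom e.symm.injective
  have hfin : ∀ i, Finite (D i) := fun i =>
    DivisionRing.finite_of_pow_eq_one hk (hpi.pi_apply i).pow_eq_one_of_matrix
  have hfinM : ∀ i, Finite (Matrix (Fin (d i)) (Fin (d i)) (D i)) := fun i =>
    inferInstanceAs (Finite (Fin (d i) → Fin (d i) → D i))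
  have hQ : Finite (R ⧸ Ring.jacobson R) := Finite.of_equiv _ e.symm.toEquiv
  refine ⟨?_, ULift (Fin r), fun i => D i.down, fun i => inferInstance, fun i => d i.down,
    fun i => hfin _, fun i => NeZero.one_le, fun i j hj hjm => ?_, ?_⟩
  · set q := Nat.card (R ⧸ Ring.jacobson R) with hq
    have hq0 : 0 < q := Nat.card_pos
    have hqJ : (q : R) ∈ Ring.jacobson R := by
      rw [← Ideal.Quotient.eq_zero_iff_mem, map_natCast, hq]
      have := Fintype.ofFinite (R ⧸ Ring.jacobson R)
      rw [Nat.card_eq_fintype_card]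
      exact Nat.cast_card_eq_zero _
    -- Applied to the unit `1 + q`, the hypothesis yields a positive integer that vanishes in `R`.
    obtain ⟨u, hu⟩ := Ring.isUnit_one_add_of_mem_jacobson hqJ
    obtain ⟨N, hN⟩ := h u
    have hpos : 1 < (1 + q) ^ (n - 1) := Nat.one_lt_pow hk (by omega)
    refine fun a ha => h.isNilpotent_of_mem_jacobson hk
      (d := ((1 + q) ^ (n - 1) - 1) ^ N) (pow_ne_zero _ (by omega)) ?_ ha
    rw [Nat.cast_pow, Nat.cast_sub hpos.le]
    simpa [hu] using hN
  · have := hpi.pi_apply i.down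
    exact this.card_pow_sub_one_dvd hj hjm
  · refine ⟨(RingHom.pi fun i => (Pi.evalRingHom _ i.down).comp e.toRingHom), ?_, ?_⟩
    · intro x y hxy
      exact e.injective (funext fun i => congrFun hxy ⟨i⟩)
    · intro i y
      refine ⟨e.symm (Pi.single (M := fun i => Matrix (Fin (d i)) (Fin (d i)) (D i)) i.down y), ?_⟩
      simp

/-! ### Matrices over finite fields -/

theorem Matrix.pow_card_eq_zero_of_isNilpotent {K : Type*} [Field K] {m : ℕ}
    {B : Matrix (Fin m) (Fin m) K} (hB : IsNilpotent B) : B ^ m = 0 := by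
  have h := (Matrix.isNilpotent_charpoly_sub_pow_of_isNilpotent hB).eq_zero
  have h2 := Matrix.aeval_self_charpoly B
  rw [sub_eq_zero.mp h] at h2
  simpa using h2

theorem pow_succ_sub_self_dvd {A : Type*} [CommRing A] (a : A) {k l : ℕ} (h : k ∣ l) :
    a ^ (k + 1) - a ∣ a ^ (l + 1) - a := by
  obtain ⟨c, rfl⟩ := h
  have h1 := sub_dvd_pow_sub_pow (a ^ k) 1 c
  rw [one_pow, ← pow_mul] at h1
  convert mul_dvd_mul_right h1 a using 1 <;> ring

theorem Matrix.pow_sub_self_pow_eq_zero {F : Type*} [Field F] [Finite F] {m n : ℕ} (hn : 1 ≤ n)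
    (hdiv : ∀ j, 1 ≤ j → j ≤ m → Nat.card F ^ j - 1 ∣ n - 1) (M : Matrix (Fin m) (Fin m) F) :
    (M ^ n - M) ^ m = 0 := by
  apply Matrix.pow_card_eq_zero_of_isNilpotent
  have h0 : M.charpoly ≠ 0 := M.charpoly_monic.ne_zero
  have hf : ∀ f ∈ UniqueFactorizationMonoid.factors M.charpoly, f ∣ X ^ n - X := by
    intro f hf
    have hirr := UniqueFactorizationMonoid.irreducible_of_factor f hf
    have hdeg : f.natDegree ≤ m := by
      simpa using natDegree_le_of_dvd (UniqueFactorizationMonoid.dvd_of_mem_factors hf) h0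
    refine (hirr.natDegree_dvd_iff_dvd_X_pow_card_pow_sub_X.mp dvd_rfl).trans ?_
    have := pow_succ_sub_self_dvd (X : F[X]) (hdiv f.natDegree hirr.natDegree_pos hdeg)
    rwa [Nat.sub_add_cancel hn, Nat.sub_add_cancel (Nat.one_le_pow _ _ Nat.card_pos)] at this
  have hdvd : M.charpoly ∣
      (X ^ n - X) ^ (UniqueFactorizationMonoid.factors M.charpoly).card := by
    refine (UniqueFactorizationMonoid.factors_prod h0).symm.dvd.trans ?_
    simpa using Multiset.prod_dvd_prod_of_dvd id (fun _ => (X ^ n - X : F[X])) hf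
  obtain ⟨c, hc⟩ := hdvd
  refine ⟨(UniqueFactorizationMonoid.factors M.charpoly).card, ?_⟩
  have := congrArg (aeval M) hc
  simpa only [map_mul, Matrix.aeval_self_charpoly, zero_mul, map_pow, map_sub, aeval_X] using this

/-! ### Lifting potents in commutative rings -/

section Commutative

variable {A : Type*} [CommRing A]

/-- A high `p`-power exponent makes `x` and `y` congruent mod `p`; each further `p`-th power
improves the congruence by a factor `p`. -/
theorem exists_forall_pow_prime_pow_eq {p : ℕ} (hp : p.Prime) {s : ℕ} (hs : (p : A) ^ s = 0)
    {x y : A} (h : IsNilpotent (x - y)) : ∃ M₀, ∀ M ≥ M₀, x ^ p ^ M = y ^ p ^ M := by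
  obtain ⟨c, hc⟩ := h
  obtain ⟨r, hr⟩ := exists_add_pow_prime_pow_eq hp y (x - y) c
  rw [pow_eq_zero_of_le (Nat.lt_pow_self hp.one_lt).le hc, add_zero, add_sub_cancel] at hr
  have h1 : (p : A) ∣ x ^ p ^ c - y ^ p ^ c := by
    exact ⟨y * (x - y) * r, by rw [hr]; ring⟩
  have h2 := dvd_sub_pow_of_dvd_sub h1 s
  rw [pow_succ, hs, zero_mul, zero_dvd_iff, sub_eq_zero, ← pow_mul, ← pow_mul, ← pow_add] at h2
  refine ⟨c + s, fun M hM => ?_⟩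
  obtain ⟨t, rfl⟩ := Nat.exists_eq_add_of_le hM
  rw [pow_add p, pow_mul, pow_mul, h2]

theorem exists_potent_of_prime_pow {p s n : ℕ} (hp : p.Prime) (hs : (p : A) ^ s = 0)
    (hn : 2 ≤ n) {a : A} (ha : IsNilpotent (a ^ n - a)) :
    ∃ e : A, e ^ n = e ∧ IsNilpotent (a - e) := by
  obtain ⟨t, k, hpk, hk⟩ := Nat.exists_eq_pow_mul_and_not_dvd (n := n - 1) (by omega) p hp.ne_one
  have hw : IsNilpotent (a ^ (k + 1) - a) := by
    obtain ⟨r, hr⟩ := exists_add_pow_prime_pow_eq hp a (a ^ (k + 1) - a) t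
    have hpt : 1 ≤ p ^ t := Nat.one_le_pow _ _ hp.pos
    rw [add_sub_cancel, ← pow_mul] at hr
    have h1 : a ^ ((k + 1) * p ^ t) - a ^ p ^ t = a ^ (p ^ t - 1) * (a ^ n - a) := by
      rw [mul_sub, ← pow_add, ← pow_succ, Nat.sub_add_cancel hpt]
      congr 2
      rw [add_mul, mul_comm, ← hk]; omega
    have h2 : (a ^ (k + 1) - a) ^ p ^ t =
        a ^ (p ^ t - 1) * (a ^ n - a) - p * (a * (a ^ (k + 1) - a) * r) := by
      rw [← h1, hr]; ring
    have h3 : IsNilpotent (p : A) := ⟨s, hs⟩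
    rw [← IsNilpotent.pow_iff_pos (n := p ^ t) (by omega), h2]
    exact (Commute.all _ _).isNilpotent_sub ((Commute.all _ _).isNilpotent_mul_left ha)
      ((Commute.all _ _).isNilpotent_mul_right h3)
  obtain ⟨M₀, hM₀⟩ := exists_forall_pow_prime_pow_eq hp hs ha
  have hk0 : 0 < k := Nat.pos_of_ne_zero (by rintro rfl; simp at hpk)
  -- `M ≥ M₀` gives potency; `φ(k) ∣ M` gives `p ^ M ≡ 1` mod `k`, keeping the power near `a`.
  set M := k.totient * M₀ with hM
  refine ⟨a ^ p ^ M, ?_, ?_⟩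
  · rw [← pow_mul, mul_comm, pow_mul]
    exact hM₀ M (Nat.le_mul_of_pos_left _ (Nat.totient_pos.mpr hk0))
  · have hmod : p ^ M ≡ 1 [MOD k] := by
      have := (Nat.ModEq.pow_totient ((Nat.Prime.coprime_iff_not_dvd hp).mpr hpk)).pow M₀
      rwa [one_pow, ← pow_mul] at this
    have h1 : 1 ≤ p ^ M := Nat.one_le_pow _ _ hp.pos
    have hdvd := pow_succ_sub_self_dvd a ((Nat.modEq_iff_dvd' h1).mp hmod.symm)
    rw [Nat.sub_add_cancel h1] at hdvd
    obtain ⟨c, hc⟩ := hdvd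
    rw [← neg_sub, hc, isNilpotent_neg_iff]
    exact (Commute.all _ _).isNilpotent_mul_right hw

theorem exists_potent_of_natCast_eq_zero {n : ℕ} (hn : 2 ≤ n) (d : ℕ) :
    ∀ {A : Type u} [CommRing A], 0 < d → (d : A) = 0 → ∀ {a : A}, IsNilpotent (a ^ n - a) →
      ∃ e : A, e ^ n = e ∧ IsNilpotent (a - e) := by
  induction d using Nat.recOnPosPrimePosCoprime with
  | zero => intro A _ h; exact absurd h (lt_irrefl _)
  | one =>
    intro A _ _ h a _
    have : Subsingleton A := subsingleton_of_zero_eq_one (by simpa using h.symm)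
    exact ⟨a, Subsingleton.elim _ _, 0, Subsingleton.elim _ _⟩
  | prime_pow p s hp _ =>
    intro A _ _ h a ha
    exact exists_potent_of_prime_pow hp (by simpa using h) hn ha
  | coprime x y hx hy hxy ihx ihy =>
    intro A _ _ h a ha
    have main : ∀ z : ℕ, 0 < z → (∀ {A : Type u} [CommRing A], 0 < z → (z : A) = 0 → ∀ {a : A},
        IsNilpotent (a ^ n - a) → ∃ e : A, e ^ n = e ∧ IsNilpotent (a - e)) →
        ∃ e : A, (z : A) ∣ e ^ n - e ∧ ∃ N, (z : A) ∣ (a - e) ^ N := by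
      intro z hz ih
      let π := Ideal.Quotient.mk (Ideal.span {(z : A)})
      obtain ⟨e, he, N, hN⟩ := ih (A := A ⧸ Ideal.span {(z : A)}) hz
        (by rw [← map_natCast π]; exact Ideal.Quotient.eq_zero_iff_mem.mpr
              (Ideal.mem_span_singleton_self _)) (a := π a) (by simpa using ha.map π)
      obtain ⟨e, rfl⟩ := Ideal.Quotient.mk_surjective e
      refine ⟨e, ?_, N, ?_⟩ <;> rw [← Ideal.mem_span_singleton, ← Ideal.Quotient.eq_zero_iff_mem]
      · simpa [sub_eq_zero] using he
      · simpa using hN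
    obtain ⟨e₁, ⟨c₁, hc₁⟩, N₁, r₁, hr₁⟩ := main x (by omega) ihx
    obtain ⟨e₂, ⟨c₂, hc₂⟩, N₂, r₂, hr₂⟩ := main y (by omega) ihy
    obtain ⟨u, v, huv⟩ : IsCoprime (x : A) (y : A) := by
      simpa using (Nat.isCoprime_iff_coprime.mpr hxy).map (Int.castRingHom A)
    have hxy0 : (x : A) * y = 0 := by simpa using h
    have hpow : ∀ {f b c : A} (N : ℕ), f * b = f * c → f * b ^ N = f * c ^ N := by
      intro f b c N hbc
      induction N with
      | zero => simp
      | succ N ihN => rw [pow_succ, ← mul_assoc, ihN, mul_right_comm, hbc]; ring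
    -- Congruent to `e₁` mod `x` and to `e₂` mod `y`.
    set e := u * x * e₂ + v * y * e₁ with he
    have hx2 : u * x * e = u * x * e₂ := by
      linear_combination u * x * he + u * v * (e₁ - e₂) * hxy0 + u * x * e₂ * huv
    have hy1 : v * y * e = v * y * e₁ := by
      linear_combination v * y * he + u * v * (e₂ - e₁) * hxy0 + v * y * e₁ * huv
    refine ⟨e, ?_, N₁ + N₂, ?_⟩
    · linear_combination (e - e ^ n) * huv + hpow n hx2 - hx2 + hpow n hy1 - hy1 +
        u * x * hc₂ + v * y * hc₁ + (u * c₂ + v * c₁) * hxy0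
    · have h2 := hpow (b := a - e) (c := a - e₂) N₂ (by rw [mul_sub, hx2, mul_sub])
      have h1 := hpow (b := a - e) (c := a - e₁) N₁ (by rw [mul_sub, hy1, mul_sub])
      rw [hr₂] at h2
      rw [hr₁] at h1
      rw [pow_add]
      linear_combination (-(a - e) ^ N₁ * (a - e) ^ N₂) * huv + (a - e) ^ N₁ * h2 +
        (a - e) ^ N₂ * h1 + ((a - e) ^ N₁ * u * r₂ + (a - e) ^ N₂ * v * r₁) * hxy0

end Commutative

/-! ### Strong nil-cleanness -/

theorem isStronglyNNilClean_of_isNilpotent_pow_sub {R : Type u} [Ring R] {n d : ℕ} (hn : 2 ≤ n)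
    (hd : 0 < d) (hdR : (d : R) = 0) (h : ∀ a : R, IsNilpotent (a ^ n - a)) :
    IsStronglyNNilClean n R := by
  intro a
  let φ : ℤ[X] →+* R := (aeval a).toRingHom
  let ψ : (ℤ[X] ⧸ RingHom.ker φ) →+* R := RingHom.kerLift φ
  have hψ : Function.Injective ψ := RingHom.kerLift_injective φ
  have hX : ψ (Ideal.Quotient.mk _ X) = a :=
    (RingHom.kerLift_mk φ X).trans (aeval_X a)
  obtain ⟨e, he, hb⟩ := exists_potent_of_natCast_eq_zero hn d
    (A := ℤ[X] ⧸ RingHom.ker φ) hd (hψ (by simpa using hdR)) (a := Ideal.Quotient.mk _ X)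
    ((IsNilpotent.map_iff hψ).mp (by simpa [hX] using h a))
  refine ⟨ψ e, a - ψ e, by rw [← map_pow, he], ?_, ?_, by simp⟩
  · simpa [hX] using hb.map ψ
  · rw [← hX, ← map_sub]
    exact (Commute.all _ _).map ψ

theorem IsNilJacobsonSubdirectMatrix.isStronglyNNilClean {R : Type u} [Ring R] {n : ℕ}
    (hn : 2 ≤ n) (h : IsNilJacobsonSubdirectMatrix n R) : IsStronglyNNilClean n R := by
  obtain ⟨hJ, ι, F, _, m, hF, hm, hdiv, f, hf, -⟩ := h
  have hcard : ∀ i j, 1 ≤ j → j ≤ m i → Nat.card (F i) ^ j ≤ n := fun i j hj hjm => by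
    have := Nat.le_of_dvd (by omega) (hdiv i j hj hjm)
    omega
  have hnil : ∀ x : R, ∀ N, (∀ i, (f (Ideal.Quotient.mk _ x) i) ^ N = 0) → IsNilpotent x := by
    intro x N hx
    rw [← IsNilpotent.pow_iff_pos N.succ_ne_zero]
    apply hJ
    rw [← Ideal.Quotient.eq_zero_iff_mem]
    apply hf
    rw [map_pow, map_pow, map_zero]
    ext1 i
    rw [Pi.pow_apply, pow_succ, hx, zero_mul]; rfl
  have hfact : IsNilpotent ((n.factorial : ℕ) : R) := by
    refine hnil _ 1 fun i => ?_
    have h0 : ((n.factorial : ℕ) : F i) = 0 := by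
      have := Fintype.ofFinite (F i)
      have h1 : Nat.card (F i) ≤ n := by simpa using hcard i 1 le_rfl (hm i)
      obtain ⟨c, hc⟩ := Nat.dvd_factorial Nat.card_pos h1
      rw [hc, Nat.card_eq_fintype_card, Nat.cast_mul, Nat.cast_card_eq_zero, zero_mul]
    rw [pow_one, map_natCast, map_natCast, Pi.natCast_apply, ← map_natCast (Matrix.scalar _), h0,
      map_zero]
  obtain ⟨N, hN⟩ := hfact
  refine isStronglyNNilClean_of_isNilpotent_pow_sub hn (d := n.factorial ^ N)
    (pow_pos n.factorial_pos _) (by simpa using hN) fun a => hnil _ n fun i => ?_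
  -- The exponent `n` serves all members of a possibly infinite family.
  have hmn : m i ≤ n := by
    have h1 : 1 < Nat.card (F i) := Finite.one_lt_card
    exact (Nat.lt_pow_self h1).le.trans (hcard i (m i) (hm i) le_rfl)
  simp only [map_sub, map_pow, Pi.sub_apply, Pi.pow_apply]
  exact pow_eq_zero_of_le hmn (Matrix.pow_sub_self_pow_eq_zero (by omega) (hdiv i) _)

theorem IsStronglyNNilClean.isNUU {R : Type*} [Ring R] {n : ℕ} (hn : 2 ≤ n)
    (h : IsStronglyNNilClean n R) : IsNUU (n - 1) R := by
  intro u
  obtain ⟨e, b, he, hb, hc, hu⟩ := h u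
  have hcu : Commute (u : R) e := by rw [hu]; exact (Commute.refl e).add_left hc.symm
  have hcb : Commute (u : R) b := by rw [hu]; exact hc.add_left (Commute.refl b)
  have heu : IsUnit e := by
    have : e = u + -b := by rw [hu]; abel
    rw [this]
    exact hb.neg.isUnit_add_left_of_commute u.isUnit hcb.symm.neg_left
  have he1 : e ^ (n - 1) = 1 := by
    apply heu.mul_left_cancel
    rw [← pow_succ', Nat.sub_add_cancel (by omega), he, mul_one]
  have hub : (u : R) - e = b := by rw [hu]; abel
  -- `u ^ (n - 1) - e ^ (n - 1)` is a multiple of `u - e = b`.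
  rw [← he1, ← hcu.mul_geom_sum₂, hub]
  refine Commute.isNilpotent_mul_right ?_ hb
  refine Commute.sum_right _ _ _ fun i _ => ?_
  exact (hcb.symm.pow_right _).mul_right (hc.symm.pow_right _)

theorem theorem2 (R : Type u) [Ring R] (n : ℕ) (hn : 2 ≤ n) :
    (IsNilJacobsonSubdirectMatrix n R → IsStronglyNNilClean n R) ∧
    (IsStronglyNNilClean n R → IsNUU (n - 1) R) ∧
    (IsSemilocal R → (Even n ∨ (∃ k : ℕ, n = 2 ^ k + 1) ∨ n = 7 ∨ n = 11) →
      [IsNUU (n - 1) R, IsStronglyNNilClean n R, IsNilJacobsonSubdirectMatrix n R].TFAE) := by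
  refine ⟨fun h => h.isStronglyNNilClean hn, fun h => h.isNUU hn, fun hs _ => ?_⟩
  tfae_have 1 → 3 := fun h => h.isNilJacobsonSubdirectMatrix hn hs
  tfae_have 3 → 2 := fun h => h.isStronglyNNilClean hn
  tfae_have 2 → 1 := fun h => h.isNUU hn
  tfae_finish
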